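/- Let $E$ be a real Banach lattice with topological dual $E'$, ordered by $f\le g$ iff $f(x)\le g(x)$ for all $x\ge 0$ in $E$; thus $E'$ is again a Banach lattice. A Banach lattice is called $\sigma$-order complete if every sequence in it that is bounded above has a supremum, and order continuous if every net $x_\alpha\downarrow 0$ in it satisfies $\|x_\alpha\|\to 0$. A sequence $(f_n)$ in $E'$ is disjoint if $|f_m|\wedge|f_n|=0$ for $m\ne n$, and is $uaw^*$-null if $|f_n|\wedge u\to 0$ in the weak* topology for every $0\le u\in E'$. We say that - $E$ has the weak Grothendieck property (WGP) if every disjoint weak*-null sequence in $E'$ is weakly null; - $E$ has the unbounded Grothendieck property (UGP) if every norm bounded $uaw^*$-null sequence in $E'$ is weakly null. **Statement.** Let $E$ be a $\sigma$-order complete Banach lattice whose dual $E'$ is order continuous. If $E$ has the WGP, then $E$ has the UGP if and only if $E$ is order continuous. Moreover, the implication "if $E$ has the UGP, then $E$ is order continuous" holds without assuming the WGP. -/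

import Mathlib

open Filter Topology

namespace BanachLattice

/-! ### The dual of a Banach lattice as a vector lattice

A (real) Banach lattice is a complete real normed space `E` with a lattice order that is
compatible with addition and with multiplication by nonnegative scalars, and with a solid norm
(`|x| ≤ |y|` implies `‖x‖ ≤ ‖y‖`). Its dual `StrongDual ℝ E` is ordered by `f ≤ g` iff
`f x ≤ g x` for every `x ≥ 0`. That this order is a lattice order is proved below. -/

section Order

variable {E : Type*} [NormedAddCommGroup E] [NormedSpace ℝ E] [Lattice E] [IsOrderedAddMonoid E]

/-- The order of the dual: `f ≤ g` iff `f x ≤ g x` for all `x ≥ 0`. -/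
instance dualPartialOrder : PartialOrder (StrongDual ℝ E) where
  le f g := ∀ x : E, 0 ≤ x → f x ≤ g x
  le_refl _ _ _ := le_rfl
  le_trans _ _ _ h₁ h₂ x hx := (h₁ x hx).trans (h₂ x hx)
  le_antisymm f g h₁ h₂ := by
    ext x
    have h : ∀ y : E, 0 ≤ y → f y = g y := fun y hy => le_antisymm (h₁ y hy) (h₂ y hy)
    rw [← posPart_sub_negPart x, map_sub, map_sub, h _ (posPart_nonneg x), h _ (negPart_nonneg x)]

theorem dual_le_iff {f g : StrongDual ℝ E} : f ≤ g ↔ ∀ x : E, 0 ≤ x → f x ≤ g x := Iff.rfl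

instance dualIsOrderedAddMonoid : IsOrderedAddMonoid (StrongDual ℝ E) where
  add_le_add_left _ _ h c x hx := by simpa using h x hx

variable [HasSolidNorm E]

theorem norm_le_of_mem_Icc {x y : E} (hy : y ∈ Set.Icc 0 x) : ‖y‖ ≤ ‖x‖ :=
  norm_le_norm_of_abs_le_abs
    (by rw [abs_of_nonneg hy.1, abs_of_nonneg (hy.1.trans hy.2)]; exact hy.2)

/-- `sup {f y : 0 ≤ y ≤ x}`, the value of the positive part of `f` at `x ≥ 0`. -/
noncomputable def posSup (f : StrongDual ℝ E) (x : E) : ℝ := sSup (f '' Set.Icc 0 x)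

theorem posSup_bddAbove (f : StrongDual ℝ E) (x : E) : BddAbove (f '' Set.Icc 0 x) := by
  refine ⟨‖f‖ * ‖x‖, ?_⟩
  rintro _ ⟨y, hy, rfl⟩
  exact ((le_abs_self _).trans (f.le_opNorm y)).trans
    (mul_le_mul_of_nonneg_left (norm_le_of_mem_Icc hy) (norm_nonneg f))

theorem le_posSup (f : StrongDual ℝ E) {x y : E} (hy : y ∈ Set.Icc 0 x) : f y ≤ posSup f x :=
  le_csSup (posSup_bddAbove f x) ⟨y, hy, rfl⟩

theorem posSup_le (f : StrongDual ℝ E) {x : E} (hx : 0 ≤ x) {a : ℝ}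
    (h : ∀ y ∈ Set.Icc 0 x, f y ≤ a) : posSup f x ≤ a := by
  refine csSup_le ⟨_, 0, ⟨le_rfl, hx⟩, rfl⟩ ?_
  rintro _ ⟨y, hy, rfl⟩
  exact h y hy

theorem posSup_nonneg (f : StrongDual ℝ E) {x : E} (hx : 0 ≤ x) : 0 ≤ posSup f x := by
  simpa using le_posSup f (x := x) (y := 0) ⟨le_rfl, hx⟩

theorem posSup_le_norm (f : StrongDual ℝ E) {x : E} (hx : 0 ≤ x) : posSup f x ≤ ‖f‖ * ‖x‖ :=
  posSup_le f hx fun y hy => ((le_abs_self _).trans (f.le_opNorm y)).trans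
    (mul_le_mul_of_nonneg_left (norm_le_of_mem_Icc hy) (norm_nonneg f))

theorem posSup_add (f : StrongDual ℝ E) {x y : E} (hx : 0 ≤ x) (hy : 0 ≤ y) :
    posSup f (x + y) = posSup f x + posSup f y := by
  apply le_antisymm
  · refine posSup_le f (add_nonneg hx hy) fun z hz => ?_
    have h₁ : z ⊓ x ∈ Set.Icc 0 x := ⟨le_inf hz.1 hx, inf_le_right⟩
    have h₂ : z - z ⊓ x ∈ Set.Icc 0 y := by
      refine ⟨sub_nonneg.2 inf_le_left, ?_⟩
      rw [sub_le_iff_le_add, ← sub_le_iff_le_add']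
      refine le_inf (sub_le_self z hy) ?_
      rw [sub_le_iff_le_add]
      exact hz.2
    have h := add_le_add (le_posSup f h₁) (le_posSup f h₂)
    rwa [← map_add, add_sub_cancel] at h
  · rw [← le_sub_iff_add_le]
    refine posSup_le f hx fun a ha => ?_
    rw [le_sub_comm]
    refine posSup_le f hy fun b hb => ?_
    rw [le_sub_iff_add_le, ← map_add]
    exact le_posSup f ⟨add_nonneg hb.1 ha.1, by rw [add_comm]; exact add_le_add ha.2 hb.2⟩

/-- The positive part `f ⊔ 0` of a functional `f`, as an additive map. -/
noncomputable def posPartHom (f : StrongDual ℝ E) : E →+ ℝ where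
  toFun x := posSup f x⁺ - posSup f x⁻
  map_zero' := by simp
  map_add' x y := by
    have h : (x + y)⁺ + (x⁻ + y⁻) = (x⁺ + y⁺) + (x + y)⁻ := by
      have h₁ := posPart_sub_negPart (x + y)
      have h₂ := posPart_sub_negPart x
      have h₃ := posPart_sub_negPart y
      rw [← sub_eq_zero]
      calc (x + y)⁺ + (x⁻ + y⁻) - (x⁺ + y⁺ + (x + y)⁻)
          = ((x + y)⁺ - (x + y)⁻) - ((x⁺ - x⁻) + (y⁺ - y⁻)) := by abel
        _ = 0 := by rw [h₁, h₂, h₃, sub_self]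
    have h' := congrArg (posSup f) h
    rw [posSup_add f (posPart_nonneg _) (add_nonneg (negPart_nonneg _) (negPart_nonneg _)),
      posSup_add f (negPart_nonneg x) (negPart_nonneg y),
      posSup_add f (add_nonneg (posPart_nonneg _) (posPart_nonneg _)) (negPart_nonneg _),
      posSup_add f (posPart_nonneg x) (posPart_nonneg y)] at h'
    linarith

theorem posPartHom_apply (f : StrongDual ℝ E) {x : E} (hx : 0 ≤ x) :
    posPartHom f x = posSup f x := by
  change posSup f x⁺ - posSup f x⁻ = posSup f x
  rw [posPart_of_nonneg hx, negPart_of_nonneg hx]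
  have : posSup f (0 : E) = 0 := by simp [posSup]
  rw [this, sub_zero]

theorem posPartHom_continuous (f : StrongDual ℝ E) : Continuous (posPartHom f) := by
  refine AddMonoidHomClass.continuous_of_bound (posPartHom f) ‖f‖ fun x => ?_
  have hp : ‖x⁺‖ ≤ ‖x‖ := norm_le_norm_of_abs_le_abs (by
    rw [abs_of_nonneg (posPart_nonneg x), ← posPart_add_negPart]
    exact le_add_of_nonneg_right (negPart_nonneg x))
  have hn : ‖x⁻‖ ≤ ‖x‖ := norm_le_norm_of_abs_le_abs (by
    rw [abs_of_nonneg (negPart_nonneg x), ← posPart_add_negPart]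
    exact le_add_of_nonneg_left (posPart_nonneg x))
  have h₁ := (posSup_le_norm f (posPart_nonneg x)).trans
    (mul_le_mul_of_nonneg_left hp (norm_nonneg f))
  have h₂ := (posSup_le_norm f (negPart_nonneg x)).trans
    (mul_le_mul_of_nonneg_left hn (norm_nonneg f))
  have h₃ := posSup_nonneg f (posPart_nonneg x)
  have h₄ := posSup_nonneg f (negPart_nonneg x)
  change |posSup f x⁺ - posSup f x⁻| ≤ _
  rw [abs_le]
  constructor <;> linarith

/-- The positive part `f ⊔ 0` of a functional `f`, by the Riesz–Kantorovich formula. -/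
noncomputable def dualPosPart (f : StrongDual ℝ E) : StrongDual ℝ E :=
  (posPartHom f).toRealLinearMap (posPartHom_continuous f)

theorem dualPosPart_apply (f : StrongDual ℝ E) {x : E} (hx : 0 ≤ x) :
    dualPosPart f x = sSup (f '' Set.Icc 0 x) :=
  posPartHom_apply f hx

theorem dualPosPart_isLUB (f : StrongDual ℝ E) : IsLUB {f, 0} (dualPosPart f) := by
  constructor
  · rintro g (rfl | rfl) x hx
    · rw [dualPosPart_apply _ hx]
      exact le_posSup _ ⟨hx, le_rfl⟩
    · rw [dualPosPart_apply _ hx]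
      exact posSup_nonneg f hx
  · intro g hg x hx
    have hf : f ≤ g := hg (by simp)
    have h0 : 0 ≤ g := hg (by simp)
    rw [dualPosPart_apply _ hx]
    refine posSup_le f hx fun y hy => (hf y hy.1).trans ?_
    have := h0 (x - y) (sub_nonneg.2 hy.2)
    rw [map_sub] at this
    simpa using this

/-- The dual of a Banach lattice is a lattice: `f ⊔ g = g + (f - g)⁺`, `f ⊓ g = f - (f - g)⁺`.
Thus `|f| = f ⊔ -f` has its usual meaning for functionals. -/
noncomputable instance dualLattice : Lattice (StrongDual ℝ E) where
  toPartialOrder := dualPartialOrder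
  sup f g := g + dualPosPart (f - g)
  inf f g := f - dualPosPart (f - g)
  le_sup_left f g := by
    have h := (dualPosPart_isLUB (f - g)).1 (Set.mem_insert _ _)
    rwa [sub_le_iff_le_add'] at h
  le_sup_right f g :=
    le_add_of_nonneg_right ((dualPosPart_isLUB (f - g)).1 (by simp))
  sup_le f g k h₁ h₂ := by
    rw [← le_sub_iff_add_le']
    refine (dualPosPart_isLUB (f - g)).2 ?_
    rintro a (rfl | rfl)
    · exact sub_le_sub_right h₁ g
    · exact sub_nonneg.2 h₂
  inf_le_left f g :=
    sub_le_self f ((dualPosPart_isLUB (f - g)).1 (by simp))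
  inf_le_right f g := by
    have h := (dualPosPart_isLUB (f - g)).1 (Set.mem_insert _ _)
    rwa [sub_le_comm] at h
  le_inf k f g h₁ h₂ := by
    rw [le_sub_comm]
    refine (dualPosPart_isLUB (f - g)).2 ?_
    rintro a (rfl | rfl)
    · exact sub_le_sub_left h₂ f
    · exact sub_nonneg.2 h₁

end Order

/-! ### Order continuity and σ-order completeness -/

/-- `E` is σ-order complete: every order bounded (from above) sequence has a supremum. -/
def IsSigmaOrderComplete (E : Type*) [PartialOrder E] : Prop :=
  ∀ x : ℕ → E, BddAbove (Set.range x) → ∃ s, IsLUB (Set.range x) s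

/-- The norm of `E` is order continuous: `x_α ↓ 0` implies `‖x_α‖ → 0`. A decreasing net enters
through its range, a nonempty downward directed set with infimum `0`; as the norm is monotone on
the positive cone, `‖x_α‖ → 0` says that the range has elements of arbitrarily small norm. -/
def IsOrderContinuous (E : Type*) [NormedAddCommGroup E] [PartialOrder E] : Prop :=
  ∀ D : Set E, D.Nonempty → DirectedOn (· ≥ ·) D → IsGLB D 0 → ∀ ε > 0, ∃ d ∈ D, ‖d‖ < ε

/-! ### Convergence in the dual and the Grothendieck-type properties -/

section Dual

variable {E : Type*} [NormedAddCommGroup E] [NormedSpace ℝ E]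

/-- `f n → g` in the weak* topology `σ(E', E)`. -/
def WeakStarTendsto (f : ℕ → StrongDual ℝ E) (g : StrongDual ℝ E) : Prop :=
  Tendsto (fun n => StrongDual.toWeakDual (f n)) atTop (𝓝 (StrongDual.toWeakDual g))

/-- `f n → g` in the weak topology `σ(E', E'')`. -/
def WeakTendsto (f : ℕ → StrongDual ℝ E) (g : StrongDual ℝ E) : Prop :=
  Tendsto (fun n => toWeakSpace ℝ (StrongDual ℝ E) (f n)) atTop
    (𝓝 (toWeakSpace ℝ (StrongDual ℝ E) g))

variable [Lattice E] [IsOrderedAddMonoid E] [HasSolidNorm E]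

/-- Unbounded absolute weak* convergence: `|f n - g| ⊓ u → 0` weak* for every `0 ≤ u` in `E'`. -/
def UawStarTendsto (f : ℕ → StrongDual ℝ E) (g : StrongDual ℝ E) : Prop :=
  ∀ u : StrongDual ℝ E, 0 ≤ u → WeakStarTendsto (fun n => |f n - g| ⊓ u) 0

/-- A pairwise disjoint sequence of functionals. -/
def IsDisjointSeq (f : ℕ → StrongDual ℝ E) : Prop :=
  ∀ m n, m ≠ n → |f m| ⊓ |f n| = 0

end Dual

section Properties

variable (E : Type*) [NormedAddCommGroup E] [NormedSpace ℝ E] [Lattice E] [IsOrderedAddMonoid E]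
  [HasSolidNorm E]

/-- The weak Grothendieck property: disjoint weak*-null sequences in `E'` are weakly null. -/
def WGP : Prop :=
  ∀ f : ℕ → StrongDual ℝ E, IsDisjointSeq f → WeakStarTendsto f 0 → WeakTendsto f 0

/-- The unbounded Grothendieck property: norm bounded `uaw*`-null sequences in `E'` are weakly
null. -/
def UGP : Prop :=
  ∀ f : ℕ → StrongDual ℝ E, (∃ C : ℝ, ∀ n, ‖f n‖ ≤ C) → UawStarTendsto f 0 → WeakTendsto f 0

end Properties

end BanachLattice

namespace BanachLattice

/-! ### Vector lattices -/

section LatticeGroup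

variable {X : Type*} [AddCommGroup X] [Lattice X] [IsOrderedAddMonoid X]

/-! Both implications compare a bounded positive sequence in `E'` with a disjoint one lying below it
(`exists_disjoint_le`), after thinning out so that the error is negligible.

UGP gives order continuity: a bounded disjoint sequence in `E'` is `uaw*`-null, hence under the UGP
weakly null and in particular weak*-null. If `d n ≥ 0` had partial sums below `x` and norms at least
`ε`, positive functionals norming the `d n` could be thinned out and made disjoint while keeping
almost all of their mass on `d n`; the disjoint functionals would then not vanish at `x`. So
decreasing sequences in the positive cone have small steps, which makes downward directed sets with
infimum 0 norm Cauchy, and the norm limit can only be that infimum.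

WGP and order continuity of `E` and `E'` give the UGP: splitting into positive and negative parts
reduces to `f n ≥ 0`. Truncations `f n ⊓ u` are weak*-null in an order interval of `E'`, hence norm
null. A subsequence is therefore a norm null perturbation of a disjoint bounded sequence. The latter
is weak*-null by order continuity of `E`, and weakly null by the WGP. Both uses of order continuity
rest on the gliding hump `IsOrderContinuous.tendsto_apply_zero`. -/

theorem add_inf_le_inf_add_inf {a b c : X} (ha : 0 ≤ a) (hb : 0 ≤ b) (hc : 0 ≤ c) :
    (a + b) ⊓ c ≤ a ⊓ c + b ⊓ c := by
  have h₁ : (a + b) ⊓ c ≤ a ⊓ c + b := by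
    rw [← sub_le_iff_le_add]
    refine le_inf (sub_le_iff_le_add.2 inf_le_left) ?_
    exact sub_le_iff_le_add.2 (inf_le_right.trans (le_add_of_nonneg_right hb))
  have h₂ : (a + b) ⊓ c ≤ a ⊓ c + c :=
    inf_le_right.trans (le_add_of_nonneg_left (le_inf ha hc))
  rw [add_inf]
  exact le_inf h₁ h₂

theorem sum_inf_le_sum_inf {ι : Type*} (s : Finset ι) {a : ι → X} {c : X} (ha : ∀ i, 0 ≤ a i)
    (hc : 0 ≤ c) : (∑ i ∈ s, a i) ⊓ c ≤ ∑ i ∈ s, a i ⊓ c := by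
  classical
  induction s using Finset.induction_on with
  | empty => simp
  | insert i s hi ih =>
    rw [Finset.sum_insert hi, Finset.sum_insert hi]
    exact (add_inf_le_inf_add_inf (ha i) (Finset.sum_nonneg fun j _ => ha j) hc).trans
      (add_le_add_right ih _)

theorem add_eq_sup_of_inf_eq_zero {a b : X} (h : a ⊓ b = 0) : a + b = a ⊔ b := by
  rw [← inf_add_sup a b, h, zero_add]

/-- Sums of disjoint positive elements are suprema, so a common upper bound of the terms also bounds
the sums. -/
theorem sum_range_le_of_pairwise_disjoint {a : ℕ → X} {u : X} (hu : 0 ≤ u)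
    (ha : ∀ n, 0 ≤ a n) (hau : ∀ n, a n ≤ u) (hd : ∀ m n, m ≠ n → a m ⊓ a n = 0) (n : ℕ) :
    ∑ k ∈ Finset.range n, a k ≤ u := by
  induction n with
  | zero => simpa using hu
  | succ n ih =>
    have h : (∑ k ∈ Finset.range n, a k) ⊓ a n = 0 := by
      refine le_antisymm ((sum_inf_le_sum_inf _ ha (ha n)).trans ?_)
        (le_inf (Finset.sum_nonneg fun k _ => ha k) (ha n))
      exact (Finset.sum_eq_zero fun k hk => hd k n (Finset.mem_range.1 hk).ne).le
    rw [Finset.sum_range_succ, add_eq_sup_of_inf_eq_zero h]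
    exact sup_le ih (hau n)

theorem sub_posPart_sub (a b : X) : a - (a - b)⁺ = a ⊓ b := by
  rw [sub_eq_iff_eq_add, posPart_def]
  have := inf_add_sup a b
  have h2 : (a - b) ⊔ 0 = a ⊔ b - b := by
    rw [sub_eq_add_neg (a ⊔ b), sup_add]
    simp [sub_eq_add_neg]
  rw [h2, add_sub_assoc', this, add_sub_cancel_right]

theorem partialSups_le_sum {y : ℕ → X} (hy : ∀ n, 0 ≤ y n) (m : ℕ) :
    partialSups y m ≤ ∑ k ∈ Finset.range (m + 1), y k :=
  partialSups_le _ _ _ fun j hj =>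
    Finset.single_le_sum (f := y) (fun i _ => hy i) (Finset.mem_range.2 (by lia))

end LatticeGroup

/-! ### The dual as a Banach lattice -/

section Dual

variable {E : Type*} [NormedAddCommGroup E] [NormedSpace ℝ E] [Lattice E] [IsOrderedAddMonoid E]

instance dualIsOrderedModule : IsOrderedModule ℝ (StrongDual ℝ E) where
  smul_le_smul_of_nonneg_left c hc f g h x hx := by
    simpa using mul_le_mul_of_nonneg_left (h x hx) hc
  smul_le_smul_of_nonneg_right f hf c d h x hx := by
    simpa using mul_le_mul_of_nonneg_right h (by simpa using hf x hx)

theorem dual_nonneg_iff {f : StrongDual ℝ E} : 0 ≤ f ↔ ∀ x : E, 0 ≤ x → 0 ≤ f x := Iff.rfl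

theorem dual_apply_mono {f : StrongDual ℝ E} (hf : 0 ≤ f) {x y : E} (h : x ≤ y) : f x ≤ f y := by
  have := dual_nonneg_iff.1 hf (y - x) (sub_nonneg.2 h)
  rwa [map_sub, sub_nonneg] at this

variable [HasSolidNorm E]

theorem norm_le_norm_of_nonneg_of_le {x y : E} (hx : 0 ≤ x) (h : x ≤ y) : ‖x‖ ≤ ‖y‖ :=
  norm_le_of_mem_Icc ⟨hx, h⟩

theorem dual_sup_apply (f g : StrongDual ℝ E) {x : E} (hx : 0 ≤ x) :
    (f ⊔ g) x = g x + posSup (f - g) x := by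
  change (g + dualPosPart (f - g)) x = _
  rw [add_apply, dualPosPart_apply _ hx]
  rfl

theorem dual_inf_apply (f g : StrongDual ℝ E) {x : E} (hx : 0 ≤ x) :
    (f ⊓ g) x = f x - posSup (f - g) x := by
  change (f - dualPosPart (f - g)) x = _
  rw [sub_apply, dualPosPart_apply _ hx]
  rfl

theorem abs_dual_apply_le (f : StrongDual ℝ E) (x : E) : |f x| ≤ |f| |x| := by
  have h₁ : ∀ y : E, 0 ≤ y → |f y| ≤ |f| y := fun y hy =>
    abs_le'.2 ⟨le_abs_self f y hy, neg_le_abs f y hy⟩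
  rw [← posPart_add_negPart x]
  nth_rw 1 [← posPart_sub_negPart x]
  rw [map_sub, map_add]
  exact (abs_sub _ _).trans
    (add_le_add (h₁ _ (posPart_nonneg x)) (h₁ _ (negPart_nonneg x)))

/-- By Riesz–Kantorovich, `|f| x` is the supremum of `f (2y - x)` over `0 ≤ y ≤ x`, and `|2y - x| ≤
x` there. -/
theorem dual_abs_apply_le (f : StrongDual ℝ E) {x : E} (hx : 0 ≤ x) : |f| x ≤ ‖f‖ * ‖x‖ := by
  rw [abs, dual_sup_apply _ _ hx, ← le_sub_iff_add_le']
  refine posSup_le _ hx fun y hy => ?_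
  rw [le_sub_iff_add_le]
  have h : ‖y + y - x‖ ≤ ‖x‖ := by
    refine norm_le_norm_of_abs_le_abs ?_
    rw [abs_of_nonneg hx]
    refine abs_le'.2 ⟨?_, ?_⟩
    · rw [sub_le_iff_le_add]
      exact add_le_add hy.2 hy.2
    · rw [neg_sub]
      exact sub_le_self x (add_nonneg hy.1 hy.1)
  calc (f - -f) y + (-f) x = f (y + y - x) := by simp; ring
    _ ≤ ‖f‖ * ‖y + y - x‖ := (le_abs_self _).trans (f.le_opNorm _)
    _ ≤ ‖f‖ * ‖x‖ := mul_le_mul_of_nonneg_left h (norm_nonneg f)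

instance dualHasSolidNorm : HasSolidNorm (StrongDual ℝ E) where
  solid f g h := by
    refine f.opNorm_le_bound (norm_nonneg g) fun x => ?_
    calc ‖f x‖ ≤ |f| |x| := abs_dual_apply_le f x
      _ ≤ |g| |x| := h _ (abs_nonneg x)
      _ ≤ ‖g‖ * ‖|x|‖ := dual_abs_apply_le g (abs_nonneg x)
      _ = ‖g‖ * ‖x‖ := by rw [norm_abs_eq_norm]

theorem exists_nonneg_dual_vector (x : E) :
    ∃ f : StrongDual ℝ E, 0 ≤ f ∧ ‖f‖ ≤ 1 ∧ ‖x‖ ≤ f |x| := by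
  obtain ⟨g, hg, hgx⟩ := exists_dual_vector'' ℝ x
  refine ⟨|g|, abs_nonneg g, (norm_abs_eq_norm g).le.trans hg, ?_⟩
  have := abs_dual_apply_le g x
  rw [hgx] at this
  exact (le_abs_self _).trans this

theorem exists_nonneg_half_norm_le_apply {f : StrongDual ℝ E} (hf : 0 ≤ f) :
    ∃ x : E, 0 ≤ x ∧ ‖x‖ ≤ 1 ∧ ‖f‖ / 2 ≤ f x := by
  rcases (norm_nonneg f).eq_or_lt with h | h
  · exact ⟨0, le_rfl, by simp, by simp [← h]⟩
  · obtain ⟨x, hx, hfx⟩ := f.exists_lt_apply_of_lt_opNorm (half_lt_self h)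
    refine ⟨|x|, abs_nonneg x, (norm_abs_eq_norm x).le.trans hx.le, hfx.le.trans ?_⟩
    simpa [abs_of_nonneg hf] using abs_dual_apply_le f x

/-- Disjoint functionals are almost supported on complementary pieces of a given `x ≥ 0`. -/
theorem exists_apply_add_apply_lt_of_inf_eq_zero {f g : StrongDual ℝ E} (h : f ⊓ g = 0) {x : E}
    (hx : 0 ≤ x) {δ : ℝ} (hδ : 0 < δ) : ∃ y ∈ Set.Icc 0 x, f (x - y) + g y < δ := by
  have h₁ := dual_inf_apply f g hx
  rw [h, zero_apply] at h₁
  by_contra! hc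
  have h₂ : posSup (f - g) x ≤ f x - δ := posSup_le _ hx fun y hy => by
    have := hc y hy
    rw [map_sub] at this
    rw [sub_apply]
    linarith
  linarith

end Dual

/-! ### Weak and weak* convergence as pointwise convergence -/

section Convergence

variable {E : Type*} [NormedAddCommGroup E] [NormedSpace ℝ E]

theorem weakStarTendsto_zero_iff {f : ℕ → StrongDual ℝ E} :
    WeakStarTendsto f 0 ↔ ∀ x : E, Tendsto (fun n => f n x) atTop (𝓝 0) :=
  tendsto_iff_forall_eval_tendsto_topDualPairing

theorem weakTendsto_zero_iff {f : ℕ → StrongDual ℝ E} :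
    WeakTendsto f 0 ↔
      ∀ φ : StrongDual ℝ (StrongDual ℝ E), Tendsto (fun n => φ (f n)) atTop (𝓝 0) := by
  have h : IsInducing fun (g : WeakSpace ℝ (StrongDual ℝ E)) (φ : StrongDual ℝ (StrongDual ℝ E)) =>
      φ ((toWeakSpace ℝ (StrongDual ℝ E)).symm g) := ⟨rfl⟩
  rw [WeakTendsto, h.tendsto_nhds_iff, tendsto_pi_nhds]
  refine forall_congr' fun φ => ?_
  simp

theorem tendsto_apply_zero_of_nonneg [Lattice E] [IsOrderedAddMonoid E]
    {f : ℕ → StrongDual ℝ E} (h : ∀ x : E, 0 ≤ x → Tendsto (fun n => f n x) atTop (𝓝 0)) (x : E) :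
    Tendsto (fun n => f n x) atTop (𝓝 0) := by
  have := (h _ (posPart_nonneg x)).sub (h _ (negPart_nonneg x))
  simpa [← map_sub] using this

end Convergence

/-- Pass to a subsequence along which each pair of indices satisfies a relation that holds
eventually in the second index. -/
theorem exists_strictMono_forall_lt {P : ℕ → ℕ → ℕ → Prop}
    (h : ∀ n m, ∀ᶠ k in atTop, P n m k) :
    ∃ φ : ℕ → ℕ, StrictMono φ ∧ ∀ i n, i < n → P n (φ i) (φ n) := by
  -- The range `n ≤ m + 1` suffices: with `m = φ k ≥ k`, it contains the index `k + 1` of the next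
  -- term.
  have h' : ∀ m, ∃ k, m < k ∧ ∀ n ≤ m + 1, ∀ l ≤ m, P n l k := fun m => by
    have h₁ : ∀ᶠ k in atTop, ∀ n ∈ Set.Iic (m + 1), ∀ l ∈ Set.Iic m, P n l k :=
      (eventually_all_finite (Set.finite_Iic _)).2 fun n _ =>
        (eventually_all_finite (Set.finite_Iic _)).2 fun l _ => h n l
    exact ((eventually_gt_atTop m).and h₁).exists
  choose g hg₁ hg₂ using h'
  let φ : ℕ → ℕ := fun n => g^[n] 0
  have hs : ∀ n, φ (n + 1) = g (φ n) := fun n => Function.iterate_succ_apply' g n 0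
  have hφ : StrictMono φ := strictMono_nat_of_lt_succ fun n => by
    rw [hs]
    exact hg₁ _
  refine ⟨φ, hφ, fun i n hin => ?_⟩
  obtain ⟨n, rfl⟩ : ∃ k, n = k + 1 := ⟨n - 1, by lia⟩
  rw [hs]
  exact hg₂ _ _ (Nat.succ_le_succ (hφ.le_apply)) _ (hφ.monotone (Nat.lt_succ_iff.1 hin))

/-! ### Monotone convergence under an order continuous norm -/

section OrderContinuous

variable {X : Type*} [NormedAddCommGroup X] [NormedSpace ℝ X] [Lattice X] [IsOrderedAddMonoid X]
  [HasSolidNorm X]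

theorem eq_zero_of_forall_nsmul_le {w d : X} (hw : 0 ≤ w) (h : ∀ n : ℕ, n • w ≤ d) : w = 0 := by
  by_contra hne
  obtain ⟨n, hn⟩ := exists_nat_gt (‖d‖ / ‖w‖)
  rw [div_lt_iff₀ (norm_pos_iff.2 hne)] at hn
  have := norm_le_norm_of_nonneg_of_le (nsmul_nonneg hw n) (h n)
  rw [← Nat.cast_smul_eq_nsmul ℝ, norm_smul, Real.norm_natCast] at this
  linarith

/-- A downward directed set that is bounded below is Cauchy. -/
theorem IsOrderContinuous.exists_norm_sub_lt (hX : IsOrderContinuous X) {D : Set X}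
    (hne : D.Nonempty) (hdir : DirectedOn (· ≥ ·) D) (hbdd : BddBelow D) {ε : ℝ} (hε : 0 < ε) :
    ∃ d ∈ D, ∀ d' ∈ D, d' ≤ d → ‖d - d'‖ < ε := by
  -- `D` itself may have no infimum, but `D` minus its lower bounds decreases to 0: if `w` is below
  -- all differences, adding `w⁺` to a lower bound of `D` gives another one, and iterating forces
  -- `w⁺ = 0`.
  let S : Set X := {z | ∃ d ∈ D, ∃ l ∈ lowerBounds D, z = d - l}
  obtain ⟨d₀, hd₀⟩ := hne
  obtain ⟨l₀, hl₀⟩ := hbdd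
  have hS : ∃ z ∈ S, ‖z‖ < ε := by
    refine hX S ⟨_, d₀, hd₀, l₀, hl₀, rfl⟩ ?_ ⟨?_, ?_⟩ ε hε
    · rintro _ ⟨d, hd, l, hl, rfl⟩ _ ⟨d', hd', l', hl', rfl⟩
      obtain ⟨e, he, h₁, h₂⟩ := hdir d hd d' hd'
      refine ⟨e - (l ⊔ l'), ⟨e, he, l ⊔ l', fun z hz => sup_le (hl hz) (hl' hz), rfl⟩, ?_, ?_⟩
      · exact sub_le_sub h₁ le_sup_left
      · exact sub_le_sub h₂ le_sup_right
    · rintro _ ⟨d, hd, l, hl, rfl⟩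
      exact sub_nonneg.2 (hl hd)
    · intro w hw
      have hw' : ∀ d ∈ D, ∀ l ∈ lowerBounds D, l + w⁺ ≤ d := fun d hd l hl => by
        rw [← le_sub_iff_add_le']
        exact sup_le (hw ⟨d, hd, l, hl, rfl⟩) (sub_nonneg.2 (hl hd))
      have hn : ∀ n : ℕ, l₀ + n • w⁺ ∈ lowerBounds D := fun n => by
        induction n with
        | zero => simpa using hl₀
        | succ n ih =>
          intro d hd
          rw [succ_nsmul, ← add_assoc]
          exact hw' d hd _ ih
      have h0 : w⁺ = 0 := eq_zero_of_forall_nsmul_le (d := d₀ - l₀) (posPart_nonneg w) fun n =>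
        le_sub_iff_add_le'.2 (hn n hd₀)
      exact (le_posPart w).trans h0.le
  obtain ⟨_, ⟨d, hd, l, hl, rfl⟩, hz⟩ := hS
  exact ⟨d, hd, fun d' hd' hdd' => (norm_le_norm_of_nonneg_of_le (sub_nonneg.2 hdd')
    (sub_le_sub_left (hl hd') d)).trans_lt hz⟩

variable [CompleteSpace X]

theorem IsOrderContinuous.exists_tendsto_of_antitone (hX : IsOrderContinuous X) {y : ℕ → X}
    (hy : Antitone y) (hbdd : BddBelow (Set.range y)) : ∃ l, Tendsto y atTop (𝓝 l) := by
  refine cauchySeq_tendsto_of_complete (Metric.cauchySeq_iff'.2 fun ε hε => ?_)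
  obtain ⟨_, ⟨N, rfl⟩, hN⟩ := hX.exists_norm_sub_lt (Set.range_nonempty y)
    (directedOn_range.2 hy.directed_ge) hbdd hε
  refine ⟨N, fun n hn => ?_⟩
  rw [dist_comm, dist_eq_norm]
  exact hN _ ⟨n, rfl⟩ (hy hn)

theorem IsOrderContinuous.exists_tendsto_of_monotone (hX : IsOrderContinuous X) {y : ℕ → X}
    (hy : Monotone y) (hbdd : BddAbove (Set.range y)) : ∃ l, Tendsto y atTop (𝓝 l) := by
  obtain ⟨u, hu⟩ := hbdd
  obtain ⟨l, hl⟩ := hX.exists_tendsto_of_antitone (y := fun n => -y n) hy.neg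
    ⟨-u, by rintro _ ⟨n, rfl⟩; exact neg_le_neg (hu ⟨n, rfl⟩)⟩
  exact ⟨-l, by simpa using hl.neg⟩

/-- The gliding hump for order bounded sequences: if `f i` is summably small on later `y n`, then
`f n` is eventually small on `y n`. -/
theorem IsOrderContinuous.tendsto_apply_zero (hX : IsOrderContinuous X) {y : ℕ → X} {x : X}
    (hy : ∀ n, 0 ≤ y n) (hyx : ∀ n, y n ≤ x) {f : ℕ → StrongDual ℝ X} (hf : ∀ n, 0 ≤ f n) {C : ℝ}
    (hC : ∀ n, ‖f n‖ ≤ C) (hs : ∀ i n, i < n → f i (y n) ≤ (1 / 2) ^ n) :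
    Tendsto (fun n => f n (y n)) atTop (𝓝 0) := by
  -- `Y N`, the norm limit of the partial suprema of this tail, decreases to some `l`. Geometric
  -- sums give `f i l ≤ 0` for every `i`, so `f n (y n)` is at most `f n (Y n - l)`.
  let z : ℕ → ℕ → X := fun N k => y (N + k)
  have hz : ∀ N, ∃ l, Tendsto (fun m => partialSups (z N) m) atTop (𝓝 l) := fun N =>
    hX.exists_tendsto_of_monotone (partialSups (z N)).monotone
      ⟨x, by rintro _ ⟨m, rfl⟩; exact partialSups_le _ _ _ fun j _ => hyx _⟩
  choose Y hY using hz
  have hle : ∀ N m, partialSups (z N) m ≤ Y N := fun N m =>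
    (partialSups (z N)).monotone.ge_of_tendsto (hY N) m
  have hyY : ∀ N, y N ≤ Y N := fun N => (le_partialSups (z N) 0).trans (hle N 0)
  have hanti : Antitone Y := antitone_nat_of_succ_le fun N => by
    refine le_of_tendsto' (hY (N + 1)) fun m => partialSups_le _ _ _ fun j hj => ?_
    refine le_trans (le_of_eq ?_) ((le_partialSups (z N) (j + 1)).trans (hle N _))
    exact congrArg y (by lia)
  obtain ⟨l, hl⟩ := hX.exists_tendsto_of_antitone hanti
    ⟨0, by rintro _ ⟨N, rfl⟩; exact (hy N).trans (hyY N)⟩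
  have hl0 : 0 ≤ l := ge_of_tendsto' hl fun N => (hy N).trans (hyY N)
  have hfY : ∀ i N, i < N → f i (Y N) ≤ 2 * (1 / 2) ^ N := fun i N hiN => by
    refine le_of_tendsto' (((f i).continuous.tendsto _).comp (hY N)) fun m => ?_
    calc f i (partialSups (z N) m) ≤ f i (∑ k ∈ Finset.range (m + 1), z N k) :=
          dual_apply_mono (hf i) (partialSups_le_sum (fun k => hy _) m)
      _ = ∑ k ∈ Finset.range (m + 1), f i (y (N + k)) := map_sum _ _ _
      _ ≤ ∑ k ∈ Finset.range (m + 1), (1 / 2 : ℝ) ^ N * (1 / 2) ^ k :=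
          Finset.sum_le_sum fun k _ => by
            rw [← pow_add]
            exact hs i (N + k) (by lia)
      _ = (1 / 2 : ℝ) ^ N * ∑ k ∈ Finset.range (m + 1), (1 / 2 : ℝ) ^ k := by
          rw [Finset.mul_sum]
      _ ≤ (1 / 2 : ℝ) ^ N * 2 := by
          gcongr
          exact sum_geometric_two_le _
      _ = 2 * (1 / 2) ^ N := mul_comm _ _
  have hfl : ∀ i, f i l ≤ 0 := fun i => by
    have h₁ : Tendsto (fun N : ℕ => 2 * (1 / 2 : ℝ) ^ N) atTop (𝓝 (2 * 0)) :=
      (tendsto_pow_atTop_nhds_zero_of_lt_one (by norm_num) (by norm_num)).const_mul 2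
    rw [mul_zero] at h₁
    exact le_of_tendsto_of_tendsto (((f i).continuous.tendsto _).comp hl) h₁
      ((eventually_gt_atTop i).mono fun N hN => hfY i N hN)
  have hlim : Tendsto (fun N => C * ‖Y N - l‖) atTop (𝓝 (C * 0)) :=
    (tendsto_iff_norm_sub_tendsto_zero.1 hl).const_mul C
  rw [mul_zero] at hlim
  refine squeeze_zero (fun n => dual_nonneg_iff.1 (hf n) _ (hy n)) (fun n => ?_) hlim
  calc f n (y n) ≤ f n (Y n) := dual_apply_mono (hf n) (hyY n)
    _ ≤ f n (Y n) - f n l := by linarith [hfl n]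
    _ = f n (Y n - l) := (map_sub _ _ _).symm
    _ ≤ ‖f n‖ * ‖Y n - l‖ := (le_abs_self _).trans ((f n).le_opNorm _)
    _ ≤ C * ‖Y n - l‖ := by gcongr; exact hC n

end OrderContinuous

/-! ### Disjoint sequences -/

section Disjoint

variable {X : Type*} [NormedAddCommGroup X] [NormedSpace ℝ X] [CompleteSpace X] [Lattice X]
  [IsOrderedAddMonoid X] [IsOrderedModule ℝ X] [HasSolidNorm X]

/-- Disjointification of a bounded positive sequence, with an explicit bound for the error. -/
theorem exists_disjoint_le {F : ℕ → X} (hF : ∀ n, 0 ≤ F n) {C : ℝ} (hC : ∀ n, ‖F n‖ ≤ C) :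
    ∃ (w : X) (v : ℕ → X), 0 ≤ w ∧ (∀ n, 0 ≤ v n) ∧ (∀ n, v n ≤ F n) ∧
      (∀ m n, m ≠ n → v m ⊓ v n = 0) ∧
      ∀ n, F n - v n ≤ ∑ i ∈ Finset.range n, ((4 : ℝ) ^ n • F i) ⊓ F n + (1 / 2 : ℝ) ^ n • w := by
  have hnn : ∀ n, 0 ≤ (1 / 2 : ℝ) ^ n • F n := fun n => smul_nonneg (by positivity) (hF n)
  have hsum : Summable fun n => (1 / 2 : ℝ) ^ n • F n := by
    refine Summable.of_norm_bounded (summable_geometric_two.mul_right C) fun n => ?_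
    rw [norm_smul, Real.norm_of_nonneg (by positivity)]
    gcongr
    exact hC n
  set w := ∑' n, (1 / 2 : ℝ) ^ n • F n with hw
  have hw0 : 0 ≤ w := tsum_nonneg hnn
  have hwF : ∀ n, (1 / 2 : ℝ) ^ n • F n ≤ w := fun n => hsum.le_tsum n fun j _ => hnn j
  let G : ℕ → X := fun n => ∑ i ∈ Finset.range n, (4 : ℝ) ^ n • F i
  have h4 : ∀ i n, 0 ≤ (4 : ℝ) ^ n • F i := fun i n => smul_nonneg (by positivity) (hF i)
  have hG : ∀ n, 0 ≤ G n := fun n => Finset.sum_nonneg fun i _ => h4 i n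
  have hw2 : ∀ n, 0 ≤ (1 / 2 : ℝ) ^ n • w := fun n => smul_nonneg (by positivity) hw0
  let v : ℕ → X := fun n => (F n - (G n + (1 / 2 : ℝ) ^ n • w))⁺
  have hdisj : ∀ i n, i < n → v i ⊓ v n = 0 := fun i n hin => by
    -- The two terms are separated by the sign of `b`: `v n` lies below `b⁻` thanks to the
    -- predecessor `F i`, and `v i` below `b⁺` because `w` absorbs `4⁻ⁿ F n`.
    let b : X := (4 : ℝ) ^ n • F i - F n
    have h₁ : v n ≤ b⁻ := by
      rw [← posPart_neg, neg_sub]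
      refine posPart_mono (sub_le_sub_left ?_ _)
      exact (Finset.single_le_sum (f := fun i => (4 : ℝ) ^ n • F i) (fun j _ => h4 j n)
        (Finset.mem_range.2 hin)).trans (le_add_of_nonneg_right (hw2 n))
    have h₂ : v i ≤ b⁺ := by
      have hpow : (1 / 4 : ℝ) ^ n ≤ (1 / 2 : ℝ) ^ i * (1 / 2) ^ n := by
        rw [show (1 / 4 : ℝ) = 1 / 2 * (1 / 2) by norm_num, mul_pow]
        gcongr ?_ * _
        exact pow_le_pow_of_le_one (by norm_num) (by norm_num) hin.le
      have hle : (1 / 4 : ℝ) ^ n • F n ≤ G i + (1 / 2 : ℝ) ^ i • w := by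
        refine le_trans ?_ (le_add_of_nonneg_left (hG i))
        calc (1 / 4 : ℝ) ^ n • F n ≤ ((1 / 2 : ℝ) ^ i * (1 / 2) ^ n) • F n :=
              smul_le_smul_of_nonneg_right hpow (hF n)
          _ = (1 / 2 : ℝ) ^ i • (1 / 2 : ℝ) ^ n • F n := mul_smul _ _ _
          _ ≤ (1 / 2 : ℝ) ^ i • w := smul_le_smul_of_nonneg_left (hwF n) (by positivity)
      have hb : (1 / 4 : ℝ) ^ n • b = F i - (1 / 4 : ℝ) ^ n • F n := by
        rw [smul_sub, smul_smul, ← mul_pow]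
        norm_num
      refine sup_le ?_ (posPart_nonneg b)
      calc F i - (G i + (1 / 2 : ℝ) ^ i • w) ≤ (1 / 4 : ℝ) ^ n • b := by
            rw [hb]
            exact sub_le_sub_left hle _
        _ ≤ (1 / 4 : ℝ) ^ n • b⁺ := smul_le_smul_of_nonneg_left (le_posPart b) (by positivity)
        _ ≤ (1 : ℝ) • b⁺ := smul_le_smul_of_nonneg_right
            (pow_le_one₀ (by norm_num) (by norm_num)) (posPart_nonneg b)
        _ = b⁺ := one_smul _ _
    exact le_antisymm ((inf_le_inf h₂ h₁).trans (posPart_inf_negPart_eq_zero b).le)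
      (le_inf (posPart_nonneg _) (posPart_nonneg _))
  refine ⟨w, v, hw0, fun n => posPart_nonneg _, fun n => ?_, fun m n hmn => ?_, fun n => ?_⟩
  · exact sup_le (sub_le_self _ (add_nonneg (hG n) (hw2 n))) (hF n)
  · rcases hmn.lt_or_gt with h | h
    · exact hdisj m n h
    · rw [inf_comm]
      exact hdisj n m h
  · rw [sub_posPart_sub, inf_comm]
    refine (add_inf_le_inf_add_inf (hG n) (hw2 n) (hF n)).trans (add_le_add ?_ inf_le_left)
    exact sum_inf_le_sum_inf _ (fun i => h4 i n) (hF n)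

end Disjoint

/-! ### The UGP forces order continuity -/

section Main

variable {E : Type*} [NormedAddCommGroup E] [NormedSpace ℝ E] [Lattice E] [IsOrderedAddMonoid E]
  [HasSolidNorm E]

theorem tendsto_apply_zero_of_sum_le {f : StrongDual ℝ E} (hf : 0 ≤ f) {d : ℕ → E} {x : E}
    (hd : ∀ n, 0 ≤ d n) (hsum : ∀ n, ∑ k ∈ Finset.range n, d k ≤ x) :
    Tendsto (fun n => f (d n)) atTop (𝓝 0) :=
  (summable_of_sum_range_le (c := f x) (fun n => dual_nonneg_iff.1 hf _ (hd n)) fun n => by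
    rw [← map_sum]
    exact dual_apply_mono hf (hsum n)).tendsto_atTop_zero

/-- The truncations `v n ⊓ u` are disjoint and below `u`, so their values at `x ≥ 0` are summable
with sum at most `u x`. -/
theorem uawStarTendsto_of_disjoint {v : ℕ → StrongDual ℝ E} (hv : ∀ n, 0 ≤ v n)
    (hd : ∀ m n, m ≠ n → v m ⊓ v n = 0) : UawStarTendsto v 0 := by
  refine fun u hu => weakStarTendsto_zero_iff.2 (tendsto_apply_zero_of_nonneg fun x hx => ?_)
  simp only [sub_zero, abs_of_nonneg (hv _)]
  have hn : ∀ n, 0 ≤ v n ⊓ u := fun n => le_inf (hv n) hu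
  have hsum := sum_range_le_of_pairwise_disjoint hu hn (fun n => inf_le_right) fun m n hmn =>
    le_antisymm ((inf_le_inf inf_le_left inf_le_left).trans (hd m n hmn).le) (le_inf (hn m) (hn n))
  refine (summable_of_sum_range_le (c := u x) (fun n => dual_nonneg_iff.1 (hn n) x hx)
    fun n => ?_).tendsto_atTop_zero
  simpa using hsum n x hx

theorem UGP.tendsto_apply_zero_of_disjoint (h : UGP E) {v : ℕ → StrongDual ℝ E}
    (hv : ∀ n, 0 ≤ v n) {C : ℝ} (hC : ∀ n, ‖v n‖ ≤ C) (hd : ∀ m n, m ≠ n → v m ⊓ v n = 0)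
    (x : E) : Tendsto (fun n => v n x) atTop (𝓝 0) :=
  weakTendsto_zero_iff.1 (h v ⟨C, hC⟩ (uawStarTendsto_of_disjoint hv hd))
    (NormedSpace.inclusionInDoubleDual ℝ E x)

theorem nat_mul_pow_le (n : ℕ) : (n : ℝ) * (1 / 4) ^ n ≤ (1 / 2) ^ n := by
  have h : (n : ℝ) ≤ 2 ^ n := by exact_mod_cast n.lt_two_pow_self.le
  calc (n : ℝ) * (1 / 4) ^ n ≤ 2 ^ n * (1 / 4) ^ n := by gcongr
    _ = (1 / 2) ^ n := by rw [← mul_pow]; norm_num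

theorem tendsto_half_pow_mul (c : ℝ) :
    Tendsto (fun n : ℕ => (1 / 2 : ℝ) ^ n * c) atTop (𝓝 0) := by
  simpa using (tendsto_pow_atTop_nhds_zero_of_lt_one (r := (1 / 2 : ℝ)) (by norm_num)
    (by norm_num)).mul_const c

theorem UGP.exists_norm_lt_of_sum_le (h : UGP E) {d : ℕ → E} {x : E} (hd : ∀ n, 0 ≤ d n)
    (hsum : ∀ n, ∑ k ∈ Finset.range n, d k ≤ x) {ε : ℝ} (hε : 0 < ε) : ∃ n, ‖d n‖ < ε := by
  by_contra! hc
  choose f hf hf1 hfd using fun n => exists_nonneg_dual_vector (d n)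
  -- The rate 1/16 beats the factor `4 ^ n` of the disjointification: `n` errors of size `4⁻ⁿ` total
  -- at most `2⁻ⁿ`.
  obtain ⟨φ, -, hφ⟩ := exists_strictMono_forall_lt
    (P := fun n i k => f i (d k) ≤ (1 / 16 : ℝ) ^ n) fun n i =>
      (tendsto_apply_zero_of_sum_le (hf i) hd hsum).eventually_le_const (by positivity)
  obtain ⟨w, v, hw, hv, hvf, hdisj, herr⟩ :=
    exists_disjoint_le (F := fun n => f (φ n)) (fun n => hf _) (C := 1) (fun n => hf1 _)
  have hlim := (h.tendsto_apply_zero_of_disjoint hv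
    (fun n => (norm_le_norm_of_nonneg_of_le (hv n) (hvf n)).trans (hf1 _)) hdisj x).add
    (tendsto_half_pow_mul (1 + w x))
  rw [add_zero] at hlim
  have hdx : ∀ n, d n ≤ x := fun n =>
    (Finset.single_le_sum (f := d) (fun i _ => hd i) (Finset.self_mem_range_succ n)).trans
      (hsum (n + 1))
  refine hε.not_ge (ge_of_tendsto' hlim fun n => ?_)
  have h₁ := herr n _ (hd (φ n))
  rw [sub_apply, add_apply, sum_apply, smul_apply, smul_eq_mul] at h₁
  have h₂ : ∑ i ∈ Finset.range n, (((4 : ℝ) ^ n • f (φ i)) ⊓ f (φ n)) (d (φ n)) ≤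
      (1 / 2 : ℝ) ^ n :=
    calc _ ≤ ∑ i ∈ Finset.range n, (1 / 4 : ℝ) ^ n := Finset.sum_le_sum fun i hi => by
          have h₃ : (((4 : ℝ) ^ n • f (φ i)) ⊓ f (φ n)) (d (φ n)) ≤ 4 ^ n * f (φ i) (d (φ n)) :=
            dual_le_iff.1 (inf_le_left : ((4 : ℝ) ^ n • f (φ i)) ⊓ f (φ n) ≤ _) _ (hd _)
          refine h₃.trans ?_
          calc (4 : ℝ) ^ n * f (φ i) (d (φ n)) ≤ 4 ^ n * (1 / 16) ^ n := by
                gcongr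
                exact hφ i n (Finset.mem_range.1 hi)
            _ = (1 / 4) ^ n := by rw [← mul_pow]; norm_num
      _ = n * (1 / 4 : ℝ) ^ n := by simp
      _ ≤ _ := nat_mul_pow_le n
  have h₄ : (1 / 2 : ℝ) ^ n * w (d (φ n)) ≤ (1 / 2 : ℝ) ^ n * w x := by
    gcongr
    exact dual_apply_mono hw (hdx _)
  have h₅ : v n (d (φ n)) ≤ v n x := dual_apply_mono (hv n) (hdx _)
  have h₆ := hfd (φ n)
  rw [abs_of_nonneg (hd _)] at h₆
  have h₇ := hc (φ n)
  linarith

theorem UGP.isOrderContinuous [CompleteSpace E] (h : UGP E) : IsOrderContinuous E := by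
  intro D hne hdir hD ε hε
  -- Otherwise one descends forever in `D` by steps of norm at least `δ`, although the steps
  -- telescope to sums below the starting point.
  have hcauchy : ∀ δ > 0, ∃ d ∈ D, ∀ d' ∈ D, d' ≤ d → ‖d - d'‖ < δ := by
    by_contra! hc
    obtain ⟨δ, hδ, hc⟩ := hc
    choose! g hgD hgle hg using hc
    obtain ⟨d₀, hd₀⟩ := hne
    let y : ℕ → E := fun n => g^[n] d₀
    have hs : ∀ n, y (n + 1) = g (y n) := fun n => Function.iterate_succ_apply' g n d₀
    have hyD : ∀ n, y n ∈ D := fun n => by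
      induction n with
      | zero => exact hd₀
      | succ n ih =>
        rw [hs]
        exact hgD _ ih
    obtain ⟨n, hn⟩ := h.exists_norm_lt_of_sum_le (d := fun n => y n - y (n + 1)) (x := y 0)
      (fun n => sub_nonneg.2 (by rw [hs]; exact hgle _ (hyD n)))
      (fun n => by
        rw [Finset.sum_range_sub']
        exact sub_le_self _ (hD.1 (hyD n))) hδ
    rw [hs] at hn
    exact (hg _ (hyD n)).not_gt hn
  choose c hcD hc using fun k : ℕ => hcauchy ((1 / 2) ^ k) (by positivity)
  have hpow : Tendsto (fun k : ℕ => (1 / 2 : ℝ) ^ k) atTop (𝓝 0) :=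
    tendsto_pow_atTop_nhds_zero_of_lt_one (by norm_num) (by norm_num)
  have hseq : CauchySeq c := by
    refine cauchySeq_of_le_tendsto_0 (fun N : ℕ => 2 * (1 / 2 : ℝ) ^ N) (fun k l N hk hl => ?_)
      (by simpa using hpow.const_mul 2)
    obtain ⟨z, hz, hzk, hzl⟩ := hdir _ (hcD k) _ (hcD l)
    have h₁ := hc k z hz hzk
    have h₂ := hc l z hz hzl
    have h₃ : (1 / 2 : ℝ) ^ k ≤ (1 / 2) ^ N :=
      pow_le_pow_of_le_one (by norm_num) (by norm_num) hk
    have h₄ : (1 / 2 : ℝ) ^ l ≤ (1 / 2) ^ N :=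
      pow_le_pow_of_le_one (by norm_num) (by norm_num) hl
    have h₅ := dist_triangle_right (c k) (c l) z
    rw [dist_eq_norm (c k) z, dist_eq_norm (c l) z] at h₅
    linarith
  obtain ⟨l, hl⟩ := cauchySeq_tendsto_of_complete hseq
  -- A common lower bound `z k` in `D` of `d` and `c k` is within `2⁻ᵏ` of `c k`, so `z k` also
  -- tends to `l` while staying below `d`.
  have hlD : l ∈ lowerBounds D := fun d hd => by
    choose z hz hzd hzc using fun k => hdir d hd (c k) (hcD k)
    have hcz : Tendsto (fun k => c k - z k) atTop (𝓝 0) :=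
      squeeze_zero_norm (fun k => (hc k (z k) (hz k) (hzc k)).le) hpow
    have hzl : Tendsto z atTop (𝓝 l) := by simpa using hl.sub hcz
    exact le_of_tendsto' hzl hzd
  have hl0 : l = 0 := le_antisymm (hD.2 hlD) (ge_of_tendsto' hl fun k => hD.1 (hcD k))
  rw [hl0] at hl
  obtain ⟨k, hk⟩ := ((tendsto_zero_iff_norm_tendsto_zero.1 hl).eventually_lt_const hε).exists
  exact ⟨c k, hcD k, hk⟩

/-! ### Order continuity and the WGP give the UGP -/

/-- In the order intervals of an order continuous dual, weak* null sequences are norm null. -/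
theorem IsOrderContinuous.tendsto_norm_zero (hE' : IsOrderContinuous (StrongDual ℝ E))
    {h : ℕ → StrongDual ℝ E} {u : StrongDual ℝ E} (h0 : ∀ n, 0 ≤ h n) (hu : ∀ n, h n ≤ u)
    (hlim : ∀ x : E, 0 ≤ x → Tendsto (fun n => h n x) atTop (𝓝 0)) :
    Tendsto (fun n => ‖h n‖) atTop (𝓝 0) := by
  refine tendsto_of_subseq_tendsto fun ns hns => ?_
  choose x hx hx1 hhx using fun n => exists_nonneg_half_norm_le_apply (h0 (ns n))
  obtain ⟨φ, -, hφ⟩ := exists_strictMono_forall_lt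
    (P := fun n i k => h (ns k) (x i) ≤ (1 / 2 : ℝ) ^ n) fun n i =>
      ((hlim (x i) (hx i)).comp hns).eventually_le_const (by positivity)
  refine ⟨φ, ?_⟩
  -- The gliding hump is applied in `E'`, with the almost norming vectors acting as positive
  -- functionals in `E''`.
  have := (hE'.tendsto_apply_zero (y := fun n => h (ns (φ n))) (fun n => h0 _) (fun n => hu _)
    (f := fun n => NormedSpace.inclusionInDoubleDual ℝ E (x (φ n)))
    (fun n g hg => by simpa using dual_nonneg_iff.1 hg _ (hx _)) (C := 1)
    (fun n => (NormedSpace.double_dual_bound ℝ E _).trans (hx1 _)) hφ).mul_const 2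
  rw [zero_mul] at this
  refine squeeze_zero (fun n => norm_nonneg _) (fun n => ?_) this
  have := hhx (φ n)
  simp only [NormedSpace.dual_def]
  linarith

/-- Bounded disjoint sequences in the dual of an order continuous lattice are weak* null. -/
theorem IsOrderContinuous.tendsto_apply_zero_of_disjoint [CompleteSpace E]
    (hE : IsOrderContinuous E) {v : ℕ → StrongDual ℝ E} (hv : ∀ n, 0 ≤ v n) {C : ℝ}
    (hC : ∀ n, ‖v n‖ ≤ C) (hd : ∀ m n, m ≠ n → v m ⊓ v n = 0) {x : E} (hx : 0 ≤ x) :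
    Tendsto (fun n => v n x) atTop (𝓝 0) := by
  have hinf : ∀ n, v n ⊓ ∑ i ∈ Finset.range n, v i = 0 := fun n => by
    rw [inf_comm]
    refine le_antisymm ((sum_inf_le_sum_inf _ hv (hv n)).trans ?_)
      (le_inf (Finset.sum_nonneg fun k _ => hv k) (hv n))
    exact (Finset.sum_eq_zero fun k hk => hd k n (Finset.mem_range.1 hk).ne).le
  -- `v n` is almost carried by `y n`, where all earlier `v i` are below `2⁻ⁿ`: this is the input of
  -- the gliding hump.
  choose y hy hlt using fun n => exists_apply_add_apply_lt_of_inf_eq_zero (hinf n) hx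
    (δ := (1 / 2) ^ n) (by positivity)
  have h₁ : ∀ n, 0 ≤ v n (x - y n) := fun n =>
    dual_nonneg_iff.1 (hv n) _ (sub_nonneg.2 (hy n).2)
  have h₂ : ∀ i n, 0 ≤ v i (y n) := fun i n => dual_nonneg_iff.1 (hv i) _ (hy n).1
  have hlt' : ∀ n, v n (x - y n) + ∑ i ∈ Finset.range n, v i (y n) < (1 / 2) ^ n := fun n => by
    simpa using hlt n
  have hlim := (hE.tendsto_apply_zero (fun n => (hy n).1) (fun n => (hy n).2) hv hC
    fun i n hin => by
      have := Finset.single_le_sum (f := fun i => v i (y n)) (fun j _ => h₂ j n)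
        (Finset.mem_range.2 hin)
      linarith [h₁ n, hlt' n]).add (tendsto_half_pow_mul 1)
  rw [add_zero] at hlim
  refine squeeze_zero (fun n => dual_nonneg_iff.1 (hv n) x hx) (fun n => ?_) hlim
  have h₃ : 0 ≤ ∑ i ∈ Finset.range n, v i (y n) := Finset.sum_nonneg fun i _ => h₂ i n
  have h₄ := hlt' n
  rw [map_sub] at h₄
  linarith

theorem WGP.weakTendsto_of_nonneg [CompleteSpace E] (hW : WGP E) (hE : IsOrderContinuous E)
    (hE' : IsOrderContinuous (StrongDual ℝ E)) {f : ℕ → StrongDual ℝ E} (hf : ∀ n, 0 ≤ f n) {C : ℝ}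
    (hC : ∀ n, ‖f n‖ ≤ C)
    (hlim : ∀ u : StrongDual ℝ E, 0 ≤ u → ∀ x : E, 0 ≤ x →
      Tendsto (fun n => (f n ⊓ u) x) atTop (𝓝 0)) : WeakTendsto f 0 := by
  refine weakTendsto_zero_iff.2 fun ψ => tendsto_of_subseq_tendsto fun ns hns => ?_
  -- For a fixed earlier term, the truncations by its multiple `4 ^ n` are norm null, so later
  -- overlaps can be made at most `4⁻ⁿ`.
  obtain ⟨φ, -, hφ⟩ := exists_strictMono_forall_lt
    (P := fun n i k => ‖((4 : ℝ) ^ n • f (ns i)) ⊓ f (ns k)‖ ≤ (1 / 4 : ℝ) ^ n) fun n i => by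
      have hu : 0 ≤ (4 : ℝ) ^ n • f (ns i) := smul_nonneg (by positivity) (hf _)
      have := (hE'.tendsto_norm_zero (fun k => le_inf (hf k) hu) (fun k => inf_le_right)
        (hlim _ hu)).comp hns
      simp only [inf_comm (_ • _)]
      exact this.eventually_le_const (by positivity)
  refine ⟨φ, ?_⟩
  obtain ⟨w, v, hw, hv, hvf, hdisj, herr⟩ :=
    exists_disjoint_le (F := fun n => f (ns (φ n))) (fun n => hf _) (fun n => hC _)
  have hvC : ∀ n, ‖v n‖ ≤ C := fun n =>
    (norm_le_norm_of_nonneg_of_le (hv n) (hvf n)).trans (hC _)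
  have hvlim := weakTendsto_zero_iff.1 (hW v
    (fun m n hmn => by rw [abs_of_nonneg (hv m), abs_of_nonneg (hv n), hdisj m n hmn])
    (weakStarTendsto_zero_iff.2 (tendsto_apply_zero_of_nonneg fun x hx =>
      hE.tendsto_apply_zero_of_disjoint hv hvC hdisj hx))) ψ
  have hdiff : Tendsto (fun n => f (ns (φ n)) - v n) atTop (𝓝 0) := by
    refine squeeze_zero_norm (fun n => ?_) (tendsto_half_pow_mul (1 + ‖w‖))
    calc ‖f (ns (φ n)) - v n‖
        ≤ ‖∑ i ∈ Finset.range n, ((4 : ℝ) ^ n • f (ns (φ i))) ⊓ f (ns (φ n)) +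
            (1 / 2 : ℝ) ^ n • w‖ :=
          norm_le_norm_of_nonneg_of_le (sub_nonneg.2 (hvf n)) (herr n)
      _ ≤ ∑ i ∈ Finset.range n, (1 / 4 : ℝ) ^ n + (1 / 2 : ℝ) ^ n * ‖w‖ := by
          refine (norm_add_le _ _).trans (add_le_add ?_ ?_)
          · exact norm_sum_le_of_le _ fun i hi => hφ i n (Finset.mem_range.1 hi)
          · rw [norm_smul, Real.norm_of_nonneg (by positivity)]
      _ = n * (1 / 4 : ℝ) ^ n + (1 / 2 : ℝ) ^ n * ‖w‖ := by simp
      _ ≤ (1 / 2 : ℝ) ^ n * (1 + ‖w‖) := by linarith [nat_mul_pow_le n]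
  have := ((ψ.continuous.tendsto _).comp hdiff).add hvlim
  simpa [Function.comp_def] using this

theorem WGP.ugp [CompleteSpace E] (hW : WGP E) (hE : IsOrderContinuous E)
    (hE' : IsOrderContinuous (StrongDual ℝ E)) : UGP E := by
  rintro f ⟨C, hC⟩ hf
  -- The hypotheses on `f` concern only `|f n|` and pass to anything positive below it, in
  -- particular to `(f n)⁺` and `(f n)⁻`.
  have key : ∀ g : ℕ → StrongDual ℝ E, (∀ n, 0 ≤ g n) → (∀ n, g n ≤ |f n|) → WeakTendsto g 0 := by
    intro g hg hgf
    refine hW.weakTendsto_of_nonneg hE hE' hg (C := C) (fun n => ?_) fun u hu x hx => ?_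
    · refine (norm_le_norm_of_nonneg_of_le (hg n) (hgf n)).trans ?_
      rw [norm_abs_eq_norm]
      exact hC n
    · have hlim := weakStarTendsto_zero_iff.1 (hf u hu) x
      simp only [sub_zero] at hlim
      exact squeeze_zero (fun n => dual_nonneg_iff.1 (le_inf (hg n) hu) x hx)
        (fun n => dual_le_iff.1 (inf_le_inf_right u (hgf n)) x hx) hlim
  have hp := key (fun n => (f n)⁺) (fun n => posPart_nonneg _) fun n =>
    sup_le (le_abs_self _) (abs_nonneg _)
  have hn := key (fun n => (f n)⁻) (fun n => negPart_nonneg _) fun n =>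
    sup_le (neg_le_abs _) (abs_nonneg _)
  rw [weakTendsto_zero_iff] at hp hn ⊢
  intro ψ
  simpa [← map_sub] using (hp ψ).sub (hn ψ)

end Main

end BanachLattice

theorem mainTheorem5 {E : Type*} [NormedAddCommGroup E] [NormedSpace ℝ E] [CompleteSpace E]
    [Lattice E] [IsOrderedAddMonoid E] [IsOrderedModule ℝ E] [HasSolidNorm E]
    (hE : BanachLattice.IsSigmaOrderComplete E)
    (hE' : BanachLattice.IsOrderContinuous (StrongDual ℝ E)) :
    (BanachLattice.WGP E → (BanachLattice.UGP E ↔ BanachLattice.IsOrderContinuous E)) ∧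
      (BanachLattice.UGP E → BanachLattice.IsOrderContinuous E) :=
  ⟨fun hW => ⟨fun h => h.isOrderContinuous, fun h => hW.ugp h hE'⟩,
    fun h => h.isOrderContinuous⟩
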